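/- Fix a dimension $n\ge 1$ and $p>0$. Cubes are open with sides parallel to the axes, and $\langle f\rangle_J=\frac1{|J|}\int_J f$. For a cube $Q\subset\mathbb R^n$ and $\varphi\in L^1(Q)$ let $$\|\varphi\|_{\mathrm{BMO}^p(Q)}=\sup_{J\subseteq Q}\big\langle|\varphi-\langle\varphi\rangle_J|^p\big\rangle_J^{1/p},\qquad [e^{\varphi}]_{A_\infty(Q)}=\sup_{J\subseteq Q}\langle e^{\varphi}\rangle_J\,e^{-\langle\varphi\rangle_J},$$ the suprema being over all subcubes $J$ of $Q$, and let $\mathrm{BMO}^p(Q)$ be the set of $\varphi\in L^1(Q)$ with $\|\varphi\|_{\mathrm{BMO}^p(Q)}<\infty$. For $\varepsilon\ge 0$ let $C(\varepsilon,p)\in[1,\infty]$ be the least constant $K$ such that $$\langle e^\varphi\rangle_J\le K\,e^{\langle\varphi\rangle_J}$$ for all $\varphi\in \mathrm{BMO}^p((0,1)^n)$ with $\|\varphi\|_{\mathrm{BMO}^p((0,1)^n)}\le\varepsilon$ and all cubes $J\subseteq(0,1)^n$, and let $\varepsilon_0(p)=\sup\{\varepsilon\ge0: C(\varepsilon,p)<\infty\}$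 (the John--Nirenberg constant of $\mathrm{BMO}^p((0,1)^n)$). For $C\ge1$ let $\Omega_C=\{x\in\mathbb R^2: e^{x_1}\le x_2\le C e^{x_1}\}$ and, for a cube $Q\subset\mathbb R^n$ and $x\in\Omega_C$, let $$\boldsymbol b_{p,C}(x)=\inf\big\{\langle|\varphi|^p\rangle_Q:\ \varphi\in L^1(Q),\ \langle\varphi\rangle_Q=x_1,\ \langle e^\varphi\rangle_Q=x_2,\ [e^\varphi]_{A_\infty(Q)}\le C\big\}.$$ Theorem. Let $Q\subset\mathbb R^n$ be a cube, and let $\{b_C\}_{C\ge1}$ be a family of real-valued functions such that, for each $C\ge 1$, $b_C$ is defined on $\Omega_C$, $b_C\le\boldsymbol b_{p,C}$ on $\Omega_C$, and $b_C(0,\cdot)$ is continuous on $[1,C]$. Then $$\varepsilon_0(p)^p\ \ge\ \limsup_{C\to\infty} b_C(0,C).$$ Furthermore, suppose that $C_0\ge1$ is such that $b_C(0,C)\ge0$ for all $C\ge C_0$ and $G(C)=\big(b_C(0,C)\big)^{1/p}$ is strictly increasing on $[C_0,\infty)$. Then for every $\varepsilon$ with $G(C_0)\le\varepsilon<\varepsilon_0(p)$,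 $$C(\varepsilon,p)\ \le\ G^{-1}(\varepsilon).$$ Here, if $\varepsilon=G(C')$ for some $C'\ge C_0$, then $G^{-1}(\varepsilon)=C'$; if $\varepsilon$ is not a value of $G$ on $[C_0,\infty)$, then $G^{-1}(\varepsilon)$ is read as the generalized inverse $\sup\{C\ge C_0: G(C)\le\varepsilon\}\in[C_0,\infty]$ (which equals $C'$ in the first case). -/

import Mathlib

open MeasureTheory Set Filter
open scoped ENNReal

noncomputable section

/-- An open cube in `ℝⁿ` with sides parallel to the coordinate axes: it is given by its lowest
corner and its (positive) side length. -/
structure AxisCube (n : ℕ) where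
  corner : Fin n → ℝ
  side : ℝ
  side_pos : 0 < side

/-- The point set `∏ᵢ (aᵢ, aᵢ + ℓ)` of a cube with corner `a` and side length `ℓ`. -/
def AxisCube.carrier {n : ℕ} (Q : AxisCube n) : Set (Fin n → ℝ) :=
  Set.pi Set.univ fun i => Set.Ioo (Q.corner i) (Q.corner i + Q.side)

/-- `J.IsSubcube Q`: the cube `J` is contained in the cube `Q`. -/
def AxisCube.IsSubcube {n : ℕ} (J Q : AxisCube n) : Prop :=
  J.carrier ⊆ Q.carrier

/-- The unit cube `(0,1)ⁿ`. -/
def unitCube (n : ℕ) : AxisCube n where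
  corner := fun _ => 0
  side := 1
  side_pos := one_pos

/-- The average `⟨f⟩_J = |J|⁻¹ ∫_J f` of a `[0,∞]`-valued function over a cube. -/
def cubeAvg {n : ℕ} (J : AxisCube n) (f : (Fin n → ℝ) → ℝ≥0∞) : ℝ≥0∞ :=
  laverage (volume.restrict J.carrier) f

/-- The (quasi-)norm `‖φ‖_{BMO^p(Q)} = sup_{J ⊆ Q} ⟨|φ - ⟨φ⟩_J|^p⟩_J^{1/p}`, with values in
`[0,∞]`. -/
def bmoNorm {n : ℕ} (p : ℝ) (Q : AxisCube n) (φ : (Fin n → ℝ) → ℝ) : ℝ≥0∞ :=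
  ⨆ (J : AxisCube n) (_ : J.IsSubcube Q),
    (cubeAvg J fun t => ENNReal.ofReal (|φ t - ⨍ s in J.carrier, φ s| ^ p)) ^ (1 / p)

/-- `φ` belongs to `BMO^p(Q)`. -/
def MemBMO {n : ℕ} (p : ℝ) (Q : AxisCube n) (φ : (Fin n → ℝ) → ℝ) : Prop :=
  IntegrableOn φ Q.carrier ∧ bmoNorm p Q φ < ∞

/-- The `A_∞(Q)`-characteristic `[w]_{A_∞(Q)} = sup_{J ⊆ Q} ⟨w⟩_J e^{-⟨log w⟩_J}` of a weight `w`,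
with values in `[0,∞]`. -/
def aInftyChar {n : ℕ} (Q : AxisCube n) (w : (Fin n → ℝ) → ℝ) : ℝ≥0∞ :=
  ⨆ (J : AxisCube n) (_ : J.IsSubcube Q),
    (cubeAvg J fun t => ENNReal.ofReal (w t)) *
      ENNReal.ofReal (Real.exp (-⨍ t in J.carrier, Real.log (w t)))

/-- The integral form of the John--Nirenberg inequality on `BMO^p((0,1)ⁿ)` at level `ε` with
constant `K`: if `‖φ‖_{BMO^p} ≤ ε`, then `⟨e^φ⟩_J ≤ K e^{⟨φ⟩_J}` for every subcube `J`. -/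
def IntegralJN (n : ℕ) (p : ℝ) (ε K : ℝ≥0∞) : Prop :=
  ∀ φ : (Fin n → ℝ) → ℝ, MemBMO p (unitCube n) φ → bmoNorm p (unitCube n) φ ≤ ε →
    ∀ J : AxisCube n, J.IsSubcube (unitCube n) →
      cubeAvg J (fun t => ENNReal.ofReal (Real.exp (φ t))) ≤
        K * ENNReal.ofReal (Real.exp (⨍ t in J.carrier, φ t))

/-- The John--Nirenberg constant `ε₀(p)` of `BMO^p((0,1)ⁿ)`: the supremum of the levels `ε` at which
the integral John--Nirenberg inequality holds with some finite constant. -/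
def epsZero (n : ℕ) (p : ℝ) : ℝ≥0∞ :=
  sSup {ε | ∃ K : ℝ≥0∞, K < ∞ ∧ IntegralJN n p ε K}

/-- The best constant `C(ε,p)` in the integral John--Nirenberg inequality at level `ε`. -/
def jnConst (n : ℕ) (ε : ℝ≥0∞) (p : ℝ) : ℝ≥0∞ :=
  sInf {K | IntegralJN n p ε K}

/-- The domain `Ω_C = {x : e^{x₁} ≤ x₂ ≤ C e^{x₁}}`. -/
def bellmanDomain (C : ℝ) : Set (ℝ × ℝ) :=
  {x | Real.exp x.1 ≤ x.2 ∧ x.2 ≤ C * Real.exp x.1}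

/-- The set `E_{x,C,Q}` of test functions: `φ ∈ L¹(Q)` with `⟨φ⟩_Q = x₁`, `⟨e^φ⟩_Q = x₂` and
`[e^φ]_{A_∞(Q)} ≤ C`. -/
def testFunctions {n : ℕ} (x : ℝ × ℝ) (C : ℝ) (Q : AxisCube n) : Set ((Fin n → ℝ) → ℝ) :=
  {φ | IntegrableOn φ Q.carrier ∧ ⨍ t in Q.carrier, φ t = x.1 ∧
    IntegrableOn (fun t => Real.exp (φ t)) Q.carrier ∧ ⨍ t in Q.carrier, Real.exp (φ t) = x.2 ∧
    aInftyChar Q (fun t => Real.exp (φ t)) ≤ ENNReal.ofReal C}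

/-- The lower Bellman function `inf {⟨|φ|^p⟩_Q : φ ∈ E_{x,C,Q}}`, with values in `[0,∞]`. -/
def lowerBellman {n : ℕ} (p C : ℝ) (Q : AxisCube n) (x : ℝ × ℝ) : ℝ≥0∞ :=
  ⨅ φ ∈ testFunctions x C Q, cubeAvg Q fun t => ENNReal.ofReal (|φ t| ^ p)

end

/-! The core is one observation. Let φ have BMO^p norm at most ε and let e^φ have characteristic
exactly C > 1. Some subcube J has exponential oscillation r = ⟨e^{φ-⟨φ⟩_J}⟩_J arbitrarily close to
C. Moving φ - ⟨φ⟩_J affinely from J to Q gives a test function for the point (0, r), so b_C(0, r) ≤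
⟨|φ-⟨φ⟩_J|^p⟩_J ≤ ε^p. Continuity in r then yields b_C(0, C) ≤ ε^p (`bellman_le_rpow`).

If ε < ε₀(p), every characteristic a at level ε is finite; either a ≤ C₀ or the observation gives
G(a) ≤ ε, which bounds C(ε, p). If ε > ε₀(p), then for each C > 1 some φ at level ε has
characteristic above C, possibly infinite. It has to be scaled to sφ, 0 ≤ s ≤ 1, with characteristic
exactly C (`exists_aInftyChar_eq`); then b_C(0, C) ≤ ε^p for all C > 1, and ε decreases to ε₀(p).

The difficulty is that the characteristic of e^{sφ} might jump to infinity as s grows. This is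
excluded by openness (`HasExpBound.exists_gt`): a bound at s implies one at some s' > s. At s = 0
this is the John–Nirenberg inequality; at s > 0 it is a Gehring-type self-improvement. Both are
proved by induction over dyadic descendants followed by Lebesgue differentiation and Fatou.
Convexity in s keeps the bound below C just beyond s. -/

namespace AxisCube

/-! ### Normalised Lebesgue measure on a cube -/

variable {n : ℕ}

/-- The uniform probability measure on a cube. -/
noncomputable def unif (J : AxisCube n) : Measure (Fin n → ℝ) :=
  (volume.restrict J.carrier univ)⁻¹ • volume.restrict J.carrier

theorem measurableSet_carrier (J : AxisCube n) : MeasurableSet J.carrier :=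
  MeasurableSet.univ_pi fun _ => measurableSet_Ioo

theorem volume_carrier (J : AxisCube n) : volume J.carrier = ENNReal.ofReal J.side ^ n := by
  simp [carrier, Real.volume_pi_Ioo]

theorem volume_carrier_ne_zero (J : AxisCube n) : volume J.carrier ≠ 0 := by
  rw [volume_carrier]
  exact pow_ne_zero _ (by simpa using J.side_pos)

theorem volume_carrier_ne_top (J : AxisCube n) : volume J.carrier ≠ ∞ := by
  rw [volume_carrier]
  exact ENNReal.pow_ne_top ENNReal.ofReal_ne_top

theorem unif_eq (J : AxisCube n) :
    J.unif = (volume J.carrier)⁻¹ • volume.restrict J.carrier := by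
  simp [unif]

instance (J : AxisCube n) : IsProbabilityMeasure J.unif := by
  constructor
  rw [unif_eq]
  simpa using ENNReal.inv_mul_cancel J.volume_carrier_ne_zero J.volume_carrier_ne_top

theorem cubeAvg_eq (J : AxisCube n) (f : (Fin n → ℝ) → ℝ≥0∞) :
    cubeAvg J f = ∫⁻ t, f t ∂J.unif := rfl

theorem integrable_unif_iff {J : AxisCube n} {f : (Fin n → ℝ) → ℝ} :
    Integrable f J.unif ↔ IntegrableOn f J.carrier := by
  rw [unif_eq, integrable_smul_measure (by simpa using J.volume_carrier_ne_top)
    (by simpa using J.volume_carrier_ne_zero)]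
  rfl

theorem ae_unif_iff {J : AxisCube n} {P : (Fin n → ℝ) → Prop} :
    (∀ᵐ y ∂J.unif, P y) ↔ ∀ᵐ y ∂volume.restrict J.carrier, P y := by
  rw [unif_eq, Measure.ae_ennreal_smul_measure_iff (by simpa using J.volume_carrier_ne_top)]

theorem IsSubcube.refl (J : AxisCube n) : J.IsSubcube J := Subset.rfl

theorem IsSubcube.trans {I J K : AxisCube n} (h : I.IsSubcube J) (h' : J.IsSubcube K) :
    I.IsSubcube K := Subset.trans h h'

theorem IsSubcube.integrable {J U : AxisCube n} (h : J.IsSubcube U) {f : (Fin n → ℝ) → ℝ}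
    (hf : Integrable f U.unif) : Integrable f J.unif :=
  integrable_unif_iff.2 ((integrable_unif_iff.1 hf).mono_set h)

/-! ### Dyadic children -/

/-- One of the `2ⁿ` dyadic children of a cube. -/
noncomputable def child (J : AxisCube n) (v : Fin n → Bool) : AxisCube n where
  corner := fun i => J.corner i + if v i then J.side / 2 else 0
  side := J.side / 2
  side_pos := half_pos J.side_pos

theorem child_isSubcube (J : AxisCube n) (v : Fin n → Bool) : (J.child v).IsSubcube J := by
  intro y hy i _
  have := hy i trivial
  have hs := J.side_pos
  simp only [child, mem_Ioo] at this ⊢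
  split_ifs at this <;> constructor <;> linarith [this.1, this.2]

theorem child_disjoint (J : AxisCube n) :
    Pairwise (Function.onFun Disjoint fun v => (J.child v).carrier) := by
  intro v w hvw
  obtain ⟨i, hi⟩ := Function.ne_iff.1 hvw
  refine Set.disjoint_left.2 fun y hv hw => ?_
  have h1 := hv i trivial
  have h2 := hw i trivial
  simp only [child, mem_Ioo] at h1 h2
  cases hvi : v i <;> cases hwi : w i <;> simp_all <;> linarith

theorem volume_child (J : AxisCube n) (v : Fin n → Bool) :
    2 ^ n * volume (J.child v).carrier = volume J.carrier := by
  rw [volume_carrier, volume_carrier, ← mul_pow]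
  congr 1
  rw [child, ← ENNReal.ofReal_ofNat 2, ← ENNReal.ofReal_mul zero_le_two]
  congr 1
  ring

/-- The children are disjoint, lie in J and have total volume |J|, so the part of J they miss is
null. -/
theorem restrict_eq_sum_child (J : AxisCube n) :
    volume.restrict J.carrier = ∑ v, volume.restrict (J.child v).carrier := by
  rw [← Measure.sum_fintype, ← Measure.restrict_iUnion J.child_disjoint
    fun v => (J.child v).measurableSet_carrier]
  refine Measure.restrict_congr_set (ae_eq_of_subset_of_measure_ge
    (iUnion_subset fun v => J.child_isSubcube v) ?_
    (MeasurableSet.iUnion fun v => (J.child v).measurableSet_carrier).nullMeasurableSet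
    J.volume_carrier_ne_top).symm
  rw [measure_iUnion J.child_disjoint fun v => (J.child v).measurableSet_carrier, tsum_fintype]
  have : ∀ v, volume (J.child v).carrier = ENNReal.ofReal (J.side / 2) ^ n := fun v => by
    rw [volume_carrier]; rfl
  rw [← J.volume_child fun _ => true]
  simp [this]

theorem unif_eq_sum_child (J : AxisCube n) :
    J.unif = ((2 : ℝ≥0∞) ^ n)⁻¹ • ∑ v, (J.child v).unif := by
  rw [unif_eq, restrict_eq_sum_child, Finset.smul_sum, Finset.smul_sum]
  refine Finset.sum_congr rfl fun v _ => ?_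
  rw [unif_eq, smul_smul, ← J.volume_child v, ENNReal.mul_inv (by simp) (by simp)]

theorem lintegral_unif (J : AxisCube n) (f : (Fin n → ℝ) → ℝ≥0∞) :
    ∫⁻ y, f y ∂J.unif = ((2 : ℝ≥0∞) ^ n)⁻¹ * ∑ v, ∫⁻ y, f y ∂(J.child v).unif := by
  conv_lhs => rw [unif_eq_sum_child]
  rw [lintegral_smul_measure, lintegral_finsetSum_measure, smul_eq_mul]

theorem integral_unif (J : AxisCube n) {f : (Fin n → ℝ) → ℝ} (hf : Integrable f J.unif) :
    ∫ y, f y ∂J.unif = ((2 : ℝ) ^ n)⁻¹ * ∑ v, ∫ y, f y ∂(J.child v).unif := by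
  conv_lhs => rw [unif_eq_sum_child]
  rw [integral_smul_measure, integral_finsetSum_measure, smul_eq_mul]
  · simp
  · exact fun v _ => (J.child_isSubcube v).integrable hf

/-- The index of the child of `J` that contains `y` (up to boundaries). -/
noncomputable def childIdx (J : AxisCube n) (y : Fin n → ℝ) : Fin n → Bool :=
  fun i => decide (J.corner i + J.side / 2 < y i)

theorem measurable_childIdx (J : AxisCube n) : Measurable J.childIdx := by
  refine measurable_pi_lambda _ fun i => measurable_to_bool ?_
  have : (fun y => J.childIdx y i) ⁻¹' {true} = {y | J.corner i + J.side / 2 < y i} := by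
    ext y
    simp [childIdx]
  rw [this]
  exact measurableSet_lt measurable_const (measurable_pi_apply i)

theorem childIdx_of_mem {J : AxisCube n} {v : Fin n → Bool} {y : Fin n → ℝ}
    (hy : y ∈ (J.child v).carrier) : J.childIdx y = v := by
  funext i
  have h := hy i trivial
  simp only [child, mem_Ioo] at h
  cases hv : v i <;> simp [hv, childIdx] at h ⊢ <;> linarith

/-- The dyadic descendant of `J` of generation `k` that contains `y`. -/
noncomputable def cubeAt : ℕ → AxisCube n → (Fin n → ℝ) → AxisCube n
  | 0, J, _ => J
  | k + 1, J, y => cubeAt k (J.child (J.childIdx y)) y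

theorem measurable_cubeAt (g : AxisCube n → ℝ≥0∞) (k : ℕ) :
    ∀ J : AxisCube n, Measurable fun y => g (cubeAt k J y) := by
  induction k with
  | zero => intro J; simp only [cubeAt]; exact measurable_const
  | succ k ih =>
    intro J
    have h : Measurable fun z : (Fin n → Bool) × (Fin n → ℝ) => g (cubeAt k (J.child z.1) z.2) :=
      measurable_from_prod_countable_right fun v => ih (J.child v)
    exact h.comp (J.measurable_childIdx.prodMk measurable_id)

theorem side_cubeAt (k : ℕ) : ∀ (J : AxisCube n) (y : Fin n → ℝ),
    (cubeAt k J y).side = J.side * (1 / 2) ^ k := by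
  induction k with
  | zero => simp [cubeAt]
  | succ k ih =>
    intro J y
    rw [cubeAt, ih, pow_succ, child]
    ring

theorem cubeAt_isSubcube (k : ℕ) : ∀ (J : AxisCube n) (y : Fin n → ℝ),
    (cubeAt k J y).IsSubcube J := by
  induction k with
  | zero => exact fun J y => .refl J
  | succ k ih => exact fun J y => (ih _ y).trans (J.child_isSubcube _)

/-- `childIdx` assigns points of a cutting hyperplane to the lower half, so boxes half-open on the
left are preserved and no null set has to be removed. -/
theorem mem_cubeAt (k : ℕ) : ∀ (J : AxisCube n) (y : Fin n → ℝ),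
    (∀ i, y i ∈ Ioc (J.corner i) (J.corner i + J.side)) →
    ∀ i, y i ∈ Ioc ((cubeAt k J y).corner i) ((cubeAt k J y).corner i + (cubeAt k J y).side) := by
  induction k with
  | zero => exact fun J y h => h
  | succ k ih =>
    intro J y h
    refine ih _ _ fun i => ?_
    have := h i
    simp only [child, childIdx, mem_Ioc, decide_eq_true_eq] at this ⊢
    split_ifs with hc <;> constructor <;> linarith [this.1, this.2]

/-- The average of `g` over the dyadic descendants of generation `k`. -/
noncomputable def treeAvg (g : AxisCube n → ℝ) : ℕ → AxisCube n → ℝ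
  | 0, J => g J
  | k + 1, J => ((2 : ℝ) ^ n)⁻¹ * ∑ v, treeAvg g k (J.child v)

theorem treeAvg_nonneg {g : AxisCube n → ℝ} (hg : ∀ J, 0 ≤ g J) (k : ℕ) :
    ∀ J, 0 ≤ treeAvg g k J := by
  induction k with
  | zero => exact hg
  | succ k ih => exact fun J => mul_nonneg (by positivity) (Finset.sum_nonneg fun v _ => ih _)

/-- Translates the combinatorial tree average into an integral of a pointwise sequence, the form to
which Fatou's lemma applies. -/
theorem lintegral_cubeAt {g : AxisCube n → ℝ} (hg : ∀ J, 0 ≤ g J) (k : ℕ) :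
    ∀ J : AxisCube n, ∫⁻ y, ENNReal.ofReal (g (cubeAt k J y)) ∂J.unif =
      ENNReal.ofReal (treeAvg g k J) := by
  induction k with
  | zero => intro J; simp [cubeAt, treeAvg]
  | succ k ih =>
    intro J
    rw [lintegral_unif, treeAvg, ENNReal.ofReal_mul (by positivity),
      ENNReal.ofReal_sum_of_nonneg fun v _ => treeAvg_nonneg hg k _]
    congr 1
    · rw [ENNReal.ofReal_inv_of_pos (by positivity), ENNReal.ofReal_pow zero_le_two]
      simp
    · refine Finset.sum_congr rfl fun v _ => ?_
      rw [← ih]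
      refine lintegral_congr_ae (ae_unif_iff.2 ?_)
      filter_upwards [ae_restrict_mem (J.child v).measurableSet_carrier] with y hy
      rw [cubeAt, childIdx_of_mem hy]

theorem avg_const (c : ℝ) : ((2 : ℝ) ^ n)⁻¹ * ∑ _v : Fin n → Bool, c = c := by
  simp

theorem avg_le_avg {f g : (Fin n → Bool) → ℝ} (h : ∀ v, f v ≤ g v) :
    ((2 : ℝ) ^ n)⁻¹ * ∑ v, f v ≤ ((2 : ℝ) ^ n)⁻¹ * ∑ v, g v :=
  mul_le_mul_of_nonneg_left (Finset.sum_le_sum fun v _ => h v) (by positivity)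

/-- Iteration of a one-generation inequality over the dyadic tree. -/
theorem treeAvg_le {g : AxisCube n → ℝ} {U : AxisCube n}
    (h : ∀ J : AxisCube n, J.IsSubcube U → ((2 : ℝ) ^ n)⁻¹ * ∑ v, g (J.child v) ≤ g J) (k : ℕ) :
    ∀ J : AxisCube n, J.IsSubcube U → treeAvg g k J ≤ g J := by
  induction k with
  | zero => exact fun J _ => le_rfl
  | succ k ih =>
    exact fun J hJ => (avg_le_avg fun v => ih _ ((J.child_isSubcube v).trans hJ)).trans (h J hJ)

theorem treeAvg_mono {f g : AxisCube n → ℝ} {U : AxisCube n}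
    (h : ∀ J : AxisCube n, J.IsSubcube U → f J ≤ g J) (k : ℕ) :
    ∀ J : AxisCube n, J.IsSubcube U → treeAvg f k J ≤ treeAvg g k J := by
  induction k with
  | zero => exact h
  | succ k ih => exact fun J hJ => avg_le_avg fun v => ih _ ((J.child_isSubcube v).trans hJ)

/-! ### Dyadic Lebesgue differentiation -/

/-- In the sup metric of `Fin n → ℝ` cubes are balls up to their boundary, so differentiation along
balls applies to them. -/
theorem carrier_ae_eq_closedBall (J : AxisCube n) :
    J.carrier =ᵐ[volume]
      Metric.closedBall (fun i => J.corner i + J.side / 2) (J.side / 2) := by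
  have h : Metric.closedBall (fun i => J.corner i + J.side / 2) (J.side / 2) =
      Icc J.corner fun i => J.corner i + J.side := by
    rw [closedBall_pi _ (half_pos J.side_pos).le, ← pi_univ_Icc]
    congr 1
    funext i
    rw [Real.closedBall_eq_Icc]
    congr 1 <;> ring
  rw [h]
  exact Measure.univ_pi_Ioo_ae_eq_Icc

theorem ae_tendsto_cubeAt {U J : AxisCube n} (hJ : J.IsSubcube U) {φ : (Fin n → ℝ) → ℝ}
    (hφ : Integrable φ U.unif) :
    ∀ᵐ y ∂J.unif, Tendsto (fun k => ∫ t, φ t ∂(cubeAt k J y).unif) atTop (nhds (φ y)) := by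
  rw [ae_unif_iff]
  -- φ is controlled only on U, so it is extended by zero.
  have hloc : LocallyIntegrable (U.carrier.indicator φ) :=
    ((integrable_indicator_iff U.measurableSet_carrier).2
      (integrable_unif_iff.1 hφ)).locallyIntegrable
  filter_upwards [ae_restrict_mem J.measurableSet_carrier,
    ae_restrict_of_ae (IsUnifLocDoublingMeasure.ae_tendsto_average volume hloc 1)] with y hy hlim
  have hside : Tendsto (fun k => (cubeAt k J y).side / 2) atTop (nhdsWithin 0 (Ioi 0)) := by
    refine tendsto_nhdsWithin_iff.2 ⟨?_, .of_forall fun k => half_pos (cubeAt k J y).side_pos⟩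
    simp only [side_cubeAt]
    have := (tendsto_pow_atTop_nhds_zero_of_lt_one (r := (1 / 2 : ℝ)) (by norm_num)
      (by norm_num)).const_mul (J.side) |>.div_const 2
    simpa using this
  -- The balls are centred at the centres of the descendants, not at y; it suffices that each
  -- contains y.
  have := hlim (fun k i => (cubeAt k J y).corner i + (cubeAt k J y).side / 2) _ hside
    (.of_forall fun k => ?_)
  · rw [indicator_of_mem (hJ hy)] at this
    refine this.congr fun k => ?_
    rw [← setAverage_congr (cubeAt k J y).carrier_ae_eq_closedBall]
    refine setAverage_congr_fun (cubeAt k J y).measurableSet_carrier (.of_forall fun z hz => ?_)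
    exact indicator_of_mem (hJ (cubeAt_isSubcube k J y hz)) _
  · rw [one_mul, mem_closedBall_iff_norm, pi_norm_le_iff_of_nonneg
      (half_pos (cubeAt k J y).side_pos).le]
    intro i
    have := mem_cubeAt k J y (fun i => Ioo_subset_Ioc_self (hy i trivial)) i
    rw [Pi.sub_apply, Real.norm_eq_abs, abs_le]
    constructor <;> linarith [this.1, this.2]

/-- A bound for the dyadic averages of `e^{tφ}` at all generations passes to the limit. -/
theorem lintegral_exp_le_of_treeAvg_le {U J : AxisCube n} (hJ : J.IsSubcube U)
    {φ : (Fin n → ℝ) → ℝ} (hφ : Integrable φ U.unif) {t B : ℝ}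
    (h : ∀ k, treeAvg (fun I => Real.exp (t * ∫ y, φ y ∂I.unif)) k J ≤ B) :
    ∫⁻ y, ENNReal.ofReal (Real.exp (t * φ y)) ∂J.unif ≤ ENNReal.ofReal B := by
  set g : AxisCube n → ℝ := fun I => Real.exp (t * ∫ y, φ y ∂I.unif)
  calc ∫⁻ y, ENNReal.ofReal (Real.exp (t * φ y)) ∂J.unif
      = ∫⁻ y, liminf (fun k => ENNReal.ofReal (g (cubeAt k J y))) atTop ∂J.unif := by
        refine lintegral_congr_ae ?_
        filter_upwards [ae_tendsto_cubeAt hJ hφ] with y hy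
        refine (Tendsto.liminf_eq ?_).symm
        exact ENNReal.tendsto_ofReal ((Real.continuous_exp.tendsto _).comp (hy.const_mul t))
    _ ≤ liminf (fun k => ∫⁻ y, ENNReal.ofReal (g (cubeAt k J y)) ∂J.unif) atTop :=
        lintegral_liminf_le fun k => measurable_cubeAt (fun I => ENNReal.ofReal (g I)) k J
    _ ≤ ENNReal.ofReal B := by
        refine liminf_le_of_le (by isBoundedDefault) fun b hb => ?_
        obtain ⟨k, hk⟩ := hb.exists
        rw [lintegral_cubeAt (g := g) (fun I => (Real.exp_pos _).le)] at hk
        exact hk.trans (ENNReal.ofReal_le_ofReal (h k))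

/-! ### Transplanting functions from one cube to another -/

/-- The affine map that takes the cube `Q` onto the cube `J`. -/
noncomputable def transplant (Q J : AxisCube n) (y : Fin n → ℝ) : Fin n → ℝ :=
  (J.side / Q.side) • y + fun i => J.corner i - J.side / Q.side * Q.corner i

/-- The image of the cube `I` under the affine map that takes `Q` onto `J`. -/
noncomputable def image (Q J I : AxisCube n) : AxisCube n where
  corner := transplant Q J I.corner
  side := J.side / Q.side * I.side
  side_pos := mul_pos (div_pos J.side_pos Q.side_pos) I.side_pos

theorem preimage_image (Q J I : AxisCube n) :
    transplant Q J ⁻¹' (image Q J I).carrier = I.carrier := by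
  have hr := div_pos J.side_pos Q.side_pos
  ext y
  simp only [carrier, image, transplant, mem_preimage, mem_univ_pi, mem_Ioo, Pi.add_apply,
    Pi.smul_apply, smul_eq_mul]
  refine forall_congr' fun i => and_congr ?_ ?_
  · rw [add_lt_add_iff_right, mul_lt_mul_iff_right₀ hr]
  · rw [add_right_comm, add_lt_add_iff_right, ← mul_add, mul_lt_mul_iff_right₀ hr]

theorem image_self (Q J : AxisCube n) : image Q J Q = J := by
  have := Q.side_pos.ne'
  cases J
  simp only [image, transplant, AxisCube.mk.injEq]
  constructor
  · funext i
    simp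
  · field_simp

theorem measurable_transplant (Q J : AxisCube n) : Measurable (transplant Q J) := by
  unfold transplant
  fun_prop

theorem surjective_transplant (Q J : AxisCube n) : Function.Surjective (transplant Q J) := by
  intro z
  have hr := (div_pos J.side_pos Q.side_pos).ne'
  refine ⟨(J.side / Q.side)⁻¹ • (z - fun i => J.corner i - J.side / Q.side * Q.corner i), ?_⟩
  rw [transplant, smul_inv_smul₀ hr, sub_add_cancel]

theorem image_isSubcube {Q J I : AxisCube n} (h : I.IsSubcube Q) :
    (image Q J I).IsSubcube J := by
  have h' : transplant Q J ⁻¹' (image Q J I).carrier ⊆ transplant Q J ⁻¹' (image Q J Q).carrier := by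
    rw [preimage_image, preimage_image]
    exact h
  rw [image_self] at h'
  exact (preimage_subset_preimage_iff (by simp [(surjective_transplant Q J).range_eq])).1 h'

theorem map_transplant_volume (Q J : AxisCube n) : ∃ κ : ℝ≥0∞, κ ≠ 0 ∧ κ ≠ ∞ ∧
    (volume : Measure (Fin n → ℝ)).map (transplant Q J) = κ • volume := by
  have hr := div_pos J.side_pos Q.side_pos
  refine ⟨ENNReal.ofReal |((J.side / Q.side) ^ Module.finrank ℝ (Fin n → ℝ))⁻¹|, ?_,
    ENNReal.ofReal_ne_top, ?_⟩
  · simp only [ne_eq, ENNReal.ofReal_eq_zero, not_le]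
    positivity
  · have : transplant Q J = (fun y => y + fun i => J.corner i - J.side / Q.side * Q.corner i) ∘
        fun y => (J.side / Q.side) • y := rfl
    rw [this, ← Measure.map_map (by fun_prop) (by fun_prop), Measure.map_addHaar_smul _ hr.ne',
      Measure.map_smul, map_add_right_eq_self]

/-- The factor by which the affine map scales volume cancels in the normalised measures; hence all
averages are affine invariant. -/
theorem map_transplant_unif (Q J I : AxisCube n) :
    I.unif.map (transplant Q J) = (image Q J I).unif := by
  obtain ⟨κ, h0, htop, hκ⟩ := map_transplant_volume Q J
  have hm := (image Q J I).measurableSet_carrier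
  have h1 : volume I.carrier = κ * volume (image Q J I).carrier := by
    rw [← preimage_image Q J I, ← Measure.map_apply (measurable_transplant Q J) hm, hκ]
    rfl
  have h2 : (volume.restrict I.carrier).map (transplant Q J) =
      κ • volume.restrict (image Q J I).carrier := by
    rw [← Measure.restrict_smul, ← hκ, Measure.restrict_map (measurable_transplant Q J) hm,
      preimage_image]
  rw [unif_eq, unif_eq, Measure.map_smul, h2, h1, smul_smul, ENNReal.mul_inv (.inl h0) (.inl htop),
    mul_right_comm, ENNReal.inv_mul_cancel h0 htop, one_mul]

theorem measurableEmbedding_transplant (Q J : AxisCube n) :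
    MeasurableEmbedding (transplant Q J) := by
  have hr := (div_pos J.side_pos Q.side_pos).ne'
  exact (measurableEmbedding_addRight (fun i => J.corner i - J.side / Q.side * Q.corner i)).comp
    (measurableEmbedding_const_smul₀ hr)

end AxisCube

/-! ### The tangent plane inequality -/

/-- With u = r², log u = 2 log r ≤ 2(r - 1) = (u - 1) - (r - 1)², and (r + 1)² ≤ 4N turns (r - 1)²
into the quadratic gain. -/
theorem log_le_sub_sq {u N : ℝ} (hu : 0 < u) (huN : u ≤ N) (hN : 1 ≤ N) :
    Real.log u ≤ (u - 1) - (u - 1) ^ 2 / (4 * N) := by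
  set r := √u
  have hr : 0 < r := Real.sqrt_pos.2 hu
  have hur : u = r ^ 2 := (Real.sq_sqrt hu.le).symm
  have h1 : Real.log u = 2 * Real.log r := by rw [hur, Real.log_pow]; norm_num
  have h2 := Real.log_le_sub_one_of_pos hr
  have h3 : (u - 1) ^ 2 / (4 * N) ≤ (r - 1) ^ 2 := by
    rw [div_le_iff₀ (by positivity)]
    have h4 : (r + 1) ^ 2 ≤ 4 * N := by nlinarith [sq_nonneg (r - 1)]
    calc (u - 1) ^ 2 = (r - 1) ^ 2 * (r + 1) ^ 2 := by rw [hur]; ring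
      _ ≤ _ := mul_le_mul_of_nonneg_left h4 (sq_nonneg _)
  nlinarith

theorem rpow_one_add_le {u δ : ℝ} (hu : 0 < u) (h0 : 0 ≤ δ) (h1 : δ ≤ 1) :
    u ^ (1 + δ) ≤ 1 + (1 + δ) * (u - 1) + δ * (u - 1) ^ 2 := by
  have h := _root_.rpow_one_add_le_one_add_mul_self (s := u - 1) (by linarith) h0 h1
  rw [add_sub_cancel] at h
  rw [Real.rpow_add hu, Real.rpow_one]
  nlinarith

/-- The tangent plane inequality behind the self-improvement of exponential integrability. -/
theorem tangent_bound {x₀ w₀ K N δ : ℝ} (hw₀ : 0 < w₀) (hK : 1 ≤ K) (hN : 1 ≤ N) (hδ : 0 ≤ δ)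
    (hδ1 : δ ≤ 1) (hsmall : 8 * N * δ * K ^ 3 ≤ 1) (hw₀K : w₀ ≤ K * Real.exp x₀) :
    ∃ α β : ℝ, ∀ x w : ℝ, 0 < w → w ≤ N * w₀ →
      2 * w ^ (1 + δ) - Real.exp ((2 + δ) * x) / w ≤
        2 * w₀ ^ (1 + δ) - Real.exp ((2 + δ) * x₀) / w₀ + α * (x - x₀) + β * (w - w₀) := by
  set P := w₀ ^ (1 + δ) with hP
  set S := Real.exp ((2 + δ) * x₀) / w₀ with hS
  have hPpos : 0 < P := Real.rpow_pos_of_pos hw₀ _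
  have hSpos : 0 < S := div_pos (Real.exp_pos _) hw₀
  -- The upper bound on w₀ enters here: it makes the convex and concave parts comparable at the base
  -- point.
  have hPS : P ≤ K ^ 3 * S := by
    rw [hS, mul_div_assoc', le_div_iff₀ hw₀, hP]
    calc w₀ ^ (1 + δ) * w₀ = w₀ ^ (2 + δ) := by
          rw [← Real.rpow_add_one hw₀.ne']; congr 1; ring
      _ ≤ (K * Real.exp x₀) ^ (2 + δ) := Real.rpow_le_rpow hw₀.le hw₀K (by linarith)
      _ = K ^ (2 + δ) * Real.exp ((2 + δ) * x₀) := by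
          rw [Real.mul_rpow (by linarith) (Real.exp_pos _).le, ← Real.exp_mul, mul_comm x₀]
      _ ≤ K ^ 3 * Real.exp ((2 + δ) * x₀) := by
          refine mul_le_mul_of_nonneg_right ?_ (Real.exp_pos _).le
          rw [← Real.rpow_natCast]
          exact Real.rpow_le_rpow_of_exponent_le hK (by push_cast; linarith)
  -- The convex term 2w^{1+δ} exceeds its tangent by at most 2Pδ(u - 1)², and -e^{(2+δ)x}/w falls
  -- below its own by at least S(u - 1)²/(4N), where u = w/w₀. The smallness of δ makes the second
  -- win.
  have hcoef : 2 * P * δ ≤ S / (4 * N) := by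
    rw [le_div_iff₀ (by positivity)]
    have h1 : P * (8 * N * δ) ≤ K ^ 3 * S * (8 * N * δ) :=
      mul_le_mul_of_nonneg_right hPS (by positivity)
    nlinarith
  -- The coefficients are the two partial derivatives at (x₀, w₀).
  refine ⟨-(S * (2 + δ)), (2 * P * (1 + δ) + S) / w₀, fun x w hw hwN => ?_⟩
  set u := w / w₀ with hu
  have hupos : 0 < u := div_pos hw hw₀
  have huN : u ≤ N := (div_le_iff₀ hw₀).2 hwN
  have hwu : w = w₀ * u := by rw [hu]; field_simp
  have h1 : w ^ (1 + δ) ≤ P * (1 + (1 + δ) * (u - 1) + δ * (u - 1) ^ 2) := by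
    rw [hwu, Real.mul_rpow hw₀.le hupos.le]
    exact mul_le_mul_of_nonneg_left (rpow_one_add_le hupos hδ hδ1) hPpos.le
  have h2 : S * (1 + (2 + δ) * (x - x₀) - (u - 1) + (u - 1) ^ 2 / (4 * N)) ≤
      Real.exp ((2 + δ) * x) / w := by
    have h3 : Real.exp ((2 + δ) * x) / w =
        S * Real.exp ((2 + δ) * (x - x₀) - Real.log u) := by
      rw [Real.exp_sub, Real.exp_log hupos, hS, hwu, div_mul_div_comm, ← Real.exp_add]
      congr 2; ring
    rw [h3]
    refine mul_le_mul_of_nonneg_left ?_ hSpos.le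
    linarith [Real.add_one_le_exp ((2 + δ) * (x - x₀) - Real.log u), log_le_sub_sq hupos huN hN]
  have h4 : (2 * P * (1 + δ) + S) / w₀ * (w - w₀) = (2 * P * (1 + δ) + S) * (u - 1) := by
    rw [hwu]; field_simp
  rw [h4]
  have h5 : 2 * P * δ * (u - 1) ^ 2 ≤ S / (4 * N) * (u - 1) ^ 2 :=
    mul_le_mul_of_nonneg_right hcoef (sq_nonneg _)
  have h6 : S / (4 * N) * (u - 1) ^ 2 = S * ((u - 1) ^ 2 / (4 * N)) := by ring
  nlinarith

/-! ### Self-improvement of exponential bounds -/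

namespace AxisCube

variable {n : ℕ}

/-- The mean value of a function over a cube. -/
noncomputable def mean (φ : (Fin n → ℝ) → ℝ) (J : AxisCube n) : ℝ := ∫ y, φ y ∂J.unif

theorem mean_child {U J : AxisCube n} (hJ : J.IsSubcube U) {φ : (Fin n → ℝ) → ℝ}
    (hφ : Integrable φ U.unif) :
    mean φ J = ((2 : ℝ) ^ n)⁻¹ * ∑ v, mean φ (J.child v) :=
  J.integral_unif (hJ.integrable hφ)

theorem mean_child_le {U J : AxisCube n} (hJ : J.IsSubcube U) {φ : (Fin n → ℝ) → ℝ}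
    (hφ : Integrable φ U.unif) (h0 : ∀ y, 0 ≤ φ y) (v : Fin n → Bool) :
    mean φ (J.child v) ≤ 2 ^ n * mean φ J := by
  rw [mean_child hJ hφ, mul_inv_cancel_left₀ (by positivity)]
  exact Finset.single_le_sum (f := fun v => mean φ (J.child v))
    (fun v _ => integral_nonneg h0) (Finset.mem_univ v)

theorem exp_mean_le {J : AxisCube n} {φ : (Fin n → ℝ) → ℝ} (hφ : Integrable φ J.unif)
    (he : Integrable (fun y => Real.exp (φ y)) J.unif) :
    Real.exp (mean φ J) ≤ mean (fun y => Real.exp (φ y)) J := by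
  have h : ∫ y, Real.exp (mean φ J) * (1 + (φ y - mean φ J)) ∂J.unif ≤
      ∫ y, Real.exp (φ y) ∂J.unif := by
    refine integral_mono (((integrable_const _).add (hφ.sub (integrable_const _))).const_mul _) he
      fun y => ?_
    have : Real.exp (φ y) = Real.exp (mean φ J) * Real.exp (φ y - mean φ J) := by
      rw [← Real.exp_add]; congr 1; ring
    simp only [this]
    refine mul_le_mul_of_nonneg_left ?_ (Real.exp_pos _).le
    linarith [Real.add_one_le_exp (φ y - mean φ J)]
  have h1 : ∫ y, (1 + (φ y - mean φ J)) ∂J.unif = 1 := by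
    rw [integral_add (integrable_const _) (hφ.sub' (integrable_const _)),
      integral_sub hφ (integrable_const _)]
    simp [mean]
  rwa [integral_const_mul, h1, mul_one] at h

theorem avg_affine {f g : (Fin n → Bool) → ℝ} {a d : ℝ} (ha : a = ((2 : ℝ) ^ n)⁻¹ * ∑ v, f v)
    (hd : d = ((2 : ℝ) ^ n)⁻¹ * ∑ v, g v) {c α β : ℝ} :
    ((2 : ℝ) ^ n)⁻¹ * ∑ v, (c + α * (f v - a) + β * (g v - d)) = c := by
  have h : ∀ v, c + α * (f v - a) + β * (g v - d) = (c - α * a - β * d) + (α * f v + β * g v) :=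
    fun v => by ring
  simp only [h]
  rw [Finset.sum_add_distrib, Finset.sum_add_distrib, ← Finset.mul_sum, ← Finset.mul_sum, mul_add,
    mul_add, avg_const, mul_left_comm _ α, mul_left_comm _ β, ← ha, ← hd]
  ring

/-- Self-improvement: a uniform bound for `⟨e^φ⟩_J e^{-⟨φ⟩_J}` gives one for a higher power. -/
theorem exists_exp_bound_of_exp_bound {U : AxisCube n} {φ : (Fin n → ℝ) → ℝ}
    (hφ : Integrable φ U.unif) {K : ℝ} (hK : 1 ≤ K)
    (h : ∀ J : AxisCube n, J.IsSubcube U →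
      ∫⁻ y, ENNReal.ofReal (Real.exp (φ y)) ∂J.unif ≤ ENNReal.ofReal (K * Real.exp (mean φ J))) :
    ∃ δ > 0, ∃ K' : ℝ, ∀ J : AxisCube n, J.IsSubcube U →
      ∫⁻ y, ENNReal.ofReal (Real.exp ((1 + δ) * φ y)) ∂J.unif ≤
        ENNReal.ofReal (K' * Real.exp ((1 + δ) * mean φ J)) := by
  -- The mean of a nonnegative function over a child is at most 2^n times its mean over the parent;
  -- δ is the largest value allowed by `tangent_bound` for this N.
  set N : ℝ := 2 ^ n
  have hN : 1 ≤ N := one_le_pow₀ one_le_two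
  set δ : ℝ := 1 / (8 * N * K ^ 3)
  have hδ : 0 < δ := by positivity
  have hδ1 : δ ≤ 1 := by
    rw [div_le_one (by positivity)]
    nlinarith [one_le_pow₀ hK (n := 3)]
  have hsmall : 8 * N * δ * K ^ 3 ≤ 1 := by
    refine le_of_eq ?_
    simp only [δ]
    field_simp
  set w : AxisCube n → ℝ := mean fun y => Real.exp (φ y)
  have hei : Integrable (fun y => Real.exp (φ y)) U.unif := by
    refine ⟨Real.continuous_exp.comp_aestronglyMeasurable hφ.1, ?_⟩
    rw [hasFiniteIntegral_iff_ofReal (.of_forall fun y => (Real.exp_pos _).le)]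
    exact (h U (.refl U)).trans_lt ENNReal.ofReal_lt_top
  have hwle : ∀ J : AxisCube n, J.IsSubcube U → w J ≤ K * Real.exp (mean φ J) := by
    intro J hJ
    have := h J hJ
    rw [← ofReal_integral_eq_lintegral_ofReal (hJ.integrable hei)
      (.of_forall fun y => (Real.exp_pos _).le)] at this
    exact (ENNReal.ofReal_le_ofReal_iff (by positivity)).1 this
  have hwge : ∀ J : AxisCube n, J.IsSubcube U → Real.exp (mean φ J) ≤ w J := fun J hJ =>
    exp_mean_le (hJ.integrable hφ) (hJ.integrable hei)
  have hwpos : ∀ J : AxisCube n, J.IsSubcube U → 0 < w J := fun J hJ =>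
    (Real.exp_pos _).trans_le (hwge J hJ)
  -- A Bellman-type function of x = ⟨φ⟩_J and w = ⟨e^φ⟩_J. The tangent plane inequality makes it
  -- decrease under averaging over children, while e^x ≤ w ≤ K e^x places it between e^{(1+δ)x} and
  -- 2K^{1+δ}e^{(1+δ)x}.
  set V : AxisCube n → ℝ := fun J =>
    2 * w J ^ (1 + δ) - Real.exp ((2 + δ) * mean φ J) / w J
  have hV : ∀ J : AxisCube n, J.IsSubcube U → ((2 : ℝ) ^ n)⁻¹ * ∑ v, V (J.child v) ≤ V J := by
    intro J hJ
    obtain ⟨α, β, hαβ⟩ := tangent_bound (hwpos J hJ) hK hN hδ.le hδ1 hsmall (hwle J hJ)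
    refine (avg_le_avg fun v => hαβ (mean φ (J.child v)) (w (J.child v))
      (hwpos _ ((J.child_isSubcube v).trans hJ))
      (mean_child_le hJ hei (fun y => (Real.exp_pos _).le) v)).trans_eq ?_
    exact avg_affine (mean_child hJ hφ) (mean_child hJ hei)
  refine ⟨δ, hδ, 2 * K ^ (1 + δ), fun J hJ => ?_⟩
  refine lintegral_exp_le_of_treeAvg_le hJ hφ fun k => ?_
  refine ((treeAvg_mono (g := V) (fun I hI => ?_) k J hJ).trans (treeAvg_le hV k J hJ)).trans ?_
  · have h1 : Real.exp ((1 + δ) * mean φ I) ≤ w I ^ (1 + δ) := by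
      rw [mul_comm, Real.exp_mul]
      exact Real.rpow_le_rpow (Real.exp_pos _).le (hwge I hI) (by linarith)
    have h2 : Real.exp ((2 + δ) * mean φ I) / w I ≤ w I ^ (1 + δ) := by
      rw [div_le_iff₀ (hwpos I hI), ← Real.rpow_add_one (hwpos I hI).ne', mul_comm, Real.exp_mul,
        show 1 + δ + 1 = 2 + δ by ring]
      exact Real.rpow_le_rpow (Real.exp_pos _).le (hwge I hI) (by linarith)
    simp only [V]
    change Real.exp ((1 + δ) * mean φ I) ≤ _
    linarith
  · have h1 : w J ^ (1 + δ) ≤ K ^ (1 + δ) * Real.exp ((1 + δ) * mean φ J) := by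
      rw [mul_comm (1 + δ) (mean φ J), Real.exp_mul, ← Real.mul_rpow (by linarith)
        (Real.exp_pos _).le]
      exact Real.rpow_le_rpow (hwpos J hJ).le (hwle J hJ) (by linarith)
    have h2 : 0 < Real.exp ((2 + δ) * mean φ J) / w J := div_pos (Real.exp_pos _) (hwpos J hJ)
    simp only [V]
    linarith

/-! ### The John--Nirenberg inequality -/

theorem integrable_abs_sub_rpow {J : AxisCube n} {φ : (Fin n → ℝ) → ℝ} (hφ : Integrable φ J.unif)
    {q : ℝ} (hq : 0 < q) (hq1 : q ≤ 1) (c : ℝ) :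
    Integrable (fun y => |φ y - c| ^ q) J.unif := by
  have hs : Integrable (fun y => φ y - c) J.unif := hφ.sub (integrable_const c)
  refine Integrable.mono' ((integrable_const (1 : ℝ)).add hs.abs)
    (hs.abs.1.aemeasurable.pow_const q).aestronglyMeasurable (.of_forall fun y => ?_)
  rw [Real.norm_of_nonneg (by positivity), Pi.add_apply]
  rcases le_total |φ y - c| 1 with h | h
  · linarith [Real.rpow_le_one (abs_nonneg _) h hq.le, abs_nonneg (φ y - c)]
  · have := Real.rpow_le_rpow_of_exponent_le h hq1
    rw [Real.rpow_one] at this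
    linarith

theorem abs_add_rpow_le {q : ℝ} (hq : 0 < q) (hq1 : q ≤ 1) (a b : ℝ) :
    |a + b| ^ q ≤ |a| ^ q + |b| ^ q :=
  (Real.rpow_le_rpow (abs_nonneg _) (abs_add_le a b) hq.le).trans
    (Real.rpow_add_le_add_rpow (abs_nonneg _) (abs_nonneg _) hq.le hq1)

/-- Subadditivity of u ↦ u^q, averaged over J. It replaces the triangle inequality for q < 1 and
controls how far means drift from cube to cube. -/
theorem abs_sub_rpow_le_mean {J : AxisCube n} {φ : (Fin n → ℝ) → ℝ} (hφ : Integrable φ J.unif)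
    {q : ℝ} (hq : 0 < q) (hq1 : q ≤ 1) (a b : ℝ) :
    |a - b| ^ q ≤ mean (fun y => |φ y - a| ^ q) J + mean (fun y => |φ y - b| ^ q) J := by
  have ha := integrable_abs_sub_rpow hφ hq hq1 a
  have hb := integrable_abs_sub_rpow hφ hq hq1 b
  have h : ∫ _y, |a - b| ^ q ∂J.unif ≤ ∫ y, |φ y - a| ^ q + |φ y - b| ^ q ∂J.unif := by
    refine integral_mono (integrable_const _) (ha.add hb) fun y => ?_
    have := abs_add_rpow_le hq hq1 (a - φ y) (φ y - b)
    rwa [sub_add_sub_cancel, abs_sub_comm a (φ y)] at this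
  rw [integral_add ha hb] at h
  simpa [mean] using h

/-- The John--Nirenberg inequality for `BMO^q`, `0 < q ≤ 1`, in integral form. -/
theorem exists_exp_bound_of_rpow_bound {U : AxisCube n} {φ : (Fin n → ℝ) → ℝ}
    (hφ : Integrable φ U.unif) {q E : ℝ} (hq : 0 < q) (hq1 : q ≤ 1) (hE : 0 < E)
    (h : ∀ J : AxisCube n, J.IsSubcube U → mean (fun y => |φ y - mean φ J| ^ q) J ≤ E) :
    ∃ t > 0, ∀ J : AxisCube n, J.IsSubcube U →
      ∫⁻ y, ENNReal.ofReal (Real.exp (t * φ y)) ∂J.unif ≤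
        ENNReal.ofReal (4 * Real.exp (t * mean φ J)) := by
  -- A bounds the jump of the mean from a cube to a child, R is the drift at which the descent
  -- stops, and t below is chosen so that e^{t(R+A)} = 4/3 bounds the growth of e^{t⟨φ⟩} up to the
  -- stop.
  set A := ((1 + 2 ^ n) * E) ^ (1 / q)
  set R := (3 * E) ^ (1 / q)
  have hA : 0 < A := by positivity
  have hR : 0 < R := by positivity
  have hRq : R ^ q = 3 * E := by
    rw [← Real.rpow_mul (by positivity), one_div_mul_cancel hq.ne', Real.rpow_one]
  have hAq : A ^ q = (1 + 2 ^ n) * E := by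
    rw [← Real.rpow_mul (by positivity), one_div_mul_cancel hq.ne', Real.rpow_one]
  set t := Real.log (4 / 3) / (R + A)
  have ht : 0 < t := div_pos (Real.log_pos (by norm_num)) (by positivity)
  have hexp : Real.exp (t * (R + A)) = 4 / 3 := by
    rw [div_mul_cancel₀ _ (by positivity), Real.exp_log (by norm_num)]
  have hjump : ∀ J : AxisCube n, J.IsSubcube U → ∀ v, |mean φ (J.child v) - mean φ J| ≤ A := by
    intro J hJ v
    have hc := (J.child_isSubcube v).trans hJ
    refine (Real.rpow_le_rpow_iff (abs_nonneg _) hA.le hq).1 ?_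
    have h1 := abs_sub_rpow_le_mean (hc.integrable hφ) hq hq1 (mean φ (J.child v)) (mean φ J)
    have h2 := mean_child_le (.refl J) (integrable_abs_sub_rpow (hJ.integrable hφ) hq hq1
      (mean φ J)) (fun y => by positivity) v
    have h3 := mul_le_mul_of_nonneg_left (h J hJ) (by positivity : (0 : ℝ) ≤ 2 ^ n)
    rw [hAq]
    linarith [h _ hc]
  set g : AxisCube n → ℝ := fun I => Real.exp (t * mean φ I)
  have hg : ∀ I, 0 < g I := fun I => Real.exp_pos _
  -- Strong induction on the generation; working with finite averages presupposes no integrability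
  -- of e^{tφ}.
  have key : ∀ k, ∀ J : AxisCube n, J.IsSubcube U → treeAvg g k J ≤ 4 * g J := by
    intro k
    induction k using Nat.strong_induction_on with
    | _ k ih =>
      intro J₀ hJ₀
      set x₀ := mean φ J₀
      have hlin : ∀ J : AxisCube n, J.IsSubcube U →
          ((2 : ℝ) ^ n)⁻¹ * ∑ v, (2 / E * mean (fun y => |φ y - x₀| ^ q) (J.child v) + 1) *
            (4 / 3 * g J₀) =
          (2 / E * mean (fun y => |φ y - x₀| ^ q) J + 1) * (4 / 3 * g J₀) := by
        intro J hJ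
        rw [← Finset.sum_mul, ← mul_assoc, Finset.sum_add_distrib, mul_add, avg_const,
          ← Finset.mul_sum, mul_left_comm,
          mean_child (.refl J) (integrable_abs_sub_rpow (hJ.integrable hφ) hq hq1 x₀)]
        ring
      have hnear : ∀ J : AxisCube n, |mean φ J - x₀| ≤ R + A → g J ≤ 4 / 3 * g J₀ := by
        intro J hJ
        rw [← hexp]
        simp only [g]
        rw [← Real.exp_add, Real.exp_le_exp, ← mul_add]
        exact mul_le_mul_of_nonneg_left (by linarith [(abs_le.1 hJ).2]) ht.le
      have hY : ∀ J : AxisCube n, 0 ≤ 2 / E * mean (fun y => |φ y - x₀| ^ q) J := fun J =>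
        mul_nonneg (by positivity) (integral_nonneg fun y => by positivity)
      -- At a stopping cube, 3E = R^q forces ⟨|φ - x₀|^q⟩_J ≥ 2E, so the factor 4 from the induction
      -- hypothesis is absorbed by 2/E times this mean.
      have hfar : ∀ j < k, ∀ J : AxisCube n, J.IsSubcube U → |mean φ J - x₀| ≤ R + A →
          R ≤ |mean φ J - x₀| → treeAvg g j J ≤
            (2 / E * mean (fun y => |φ y - x₀| ^ q) J + 1) * (4 / 3 * g J₀) := by
        intro j hj J hJ hJA hJR
        have h1 := Real.rpow_le_rpow hR.le hJR hq.le
        have h2 := abs_sub_rpow_le_mean (hJ.integrable hφ) hq hq1 (mean φ J) x₀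
        have h3 : 4 ≤ 2 / E * mean (fun y => |φ y - x₀| ^ q) J := by
          rw [div_mul_eq_mul_div, le_div_iff₀ hE]
          linarith [h J hJ]
        refine ((ih j hj J hJ).trans (mul_le_mul_of_nonneg_left (hnear J hJA) zero_le_four)).trans ?_
        exact mul_le_mul_of_nonneg_right (by linarith) (by linarith [hg J₀])
      -- The descent goes on while the drift is below R, so a child's drift is at most R + A. The
      -- right-hand side is an average over J, hence exactly preserved when averaged over children.
      have hstep : ∀ j < k, ∀ J : AxisCube n, J.IsSubcube U → |mean φ J - x₀| ≤ R + A →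
          treeAvg g j J ≤
            (2 / E * mean (fun y => |φ y - x₀| ^ q) J + 1) * (4 / 3 * g J₀) := by
        intro j
        induction j with
        | zero =>
          intro hj J hJ hJA
          refine (hnear J hJA).trans (le_mul_of_one_le_left (by linarith [hg J₀]) ?_)
          linarith [hY J]
        | succ j ihj =>
          intro hj J hJ hJA
          rcases le_or_gt R |mean φ J - x₀| with hR' | hR'
          · exact hfar _ hj J hJ hJA hR'
          · refine (avg_le_avg fun v => ihj (by omega) _ ((J.child_isSubcube v).trans hJ) ?_).trans
              (hlin J hJ).le
            linarith [abs_sub_le (mean φ (J.child v)) (mean φ J) x₀, hjump J hJ v]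
      match k, hstep with
      | 0, _ => simp only [treeAvg]; linarith [hg J₀]
      | k + 1, hstep =>
        refine ((avg_le_avg fun v => hstep k (by omega) _ ((J₀.child_isSubcube v).trans hJ₀)
          ((hjump J₀ hJ₀ v).trans (by linarith))).trans (hlin J₀ hJ₀).le).trans ?_
        -- At the top cube the mean is at most E, so the factor is at most 3, and 3 · 4/3 = 4 closes
        -- the induction.
        have h1 : 2 / E * mean (fun y => |φ y - x₀| ^ q) J₀ ≤ 2 := by
          rw [div_mul_eq_mul_div, div_le_iff₀ hE]
          linarith [h J₀ hJ₀]
        calc _ ≤ (2 + 1) * (4 / 3 * g J₀) :=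
              mul_le_mul_of_nonneg_right (by linarith) (by linarith [hg J₀])
          _ = 4 * g J₀ := by ring
  exact ⟨t, ht, fun J hJ => lintegral_exp_le_of_treeAvg_le hJ hφ fun k => key k J hJ⟩

end AxisCube

/-! ### Exponential bounds as a function of the exponent s -/

namespace AxisCube

variable {n : ℕ}

theorem mean_const_mul (φ : (Fin n → ℝ) → ℝ) (s : ℝ) (J : AxisCube n) :
    mean (fun y => s * φ y) J = s * mean φ J := integral_const_mul _ _

/-- Uniform exponential integrability of the oscillation `s (φ - ⟨φ⟩_J)` over the subcubes of
`U`. -/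
def HasExpBound (φ : (Fin n → ℝ) → ℝ) (U : AxisCube n) (s K : ℝ) : Prop :=
  ∀ J : AxisCube n, J.IsSubcube U →
    ∫⁻ y, ENNReal.ofReal (Real.exp (s * (φ y - mean φ J))) ∂J.unif ≤ ENNReal.ofReal K

theorem lintegral_exp_osc (φ : (Fin n → ℝ) → ℝ) (J : AxisCube n) (s : ℝ) :
    ∫⁻ y, ENNReal.ofReal (Real.exp (s * (φ y - mean φ J))) ∂J.unif =
      (∫⁻ y, ENNReal.ofReal (Real.exp (s * φ y)) ∂J.unif) *
        ENNReal.ofReal (Real.exp (-(s * mean φ J))) := by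
  rw [← lintegral_mul_const' _ _ ENNReal.ofReal_ne_top]
  refine lintegral_congr fun y => ?_
  rw [← ENNReal.ofReal_mul (Real.exp_pos _).le, ← Real.exp_add]
  congr 2
  ring

theorem ofReal_exp_neg_mul_cancel (a : ℝ) (x : ℝ≥0∞) :
    x * ENNReal.ofReal (Real.exp (-a)) * ENNReal.ofReal (Real.exp a) = x := by
  rw [mul_assoc, ← ENNReal.ofReal_mul (Real.exp_pos _).le, ← Real.exp_add]
  simp

theorem lintegral_exp_le_iff (φ : (Fin n → ℝ) → ℝ) (J : AxisCube n) (s : ℝ) (K : ℝ≥0∞) :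
    ∫⁻ y, ENNReal.ofReal (Real.exp (s * (φ y - mean φ J))) ∂J.unif ≤ K ↔
      ∫⁻ y, ENNReal.ofReal (Real.exp (s * φ y)) ∂J.unif ≤
        K * ENNReal.ofReal (Real.exp (s * mean φ J)) := by
  rw [lintegral_exp_osc]
  constructor <;> intro h
  · have := mul_le_mul_left h (ENNReal.ofReal (Real.exp (s * mean φ J)))
    rwa [ofReal_exp_neg_mul_cancel] at this
  · have := mul_le_mul_left h (ENNReal.ofReal (Real.exp (-(s * mean φ J))))
    rwa [mul_assoc K, ← ENNReal.ofReal_mul (Real.exp_pos _).le, ← Real.exp_add, add_neg_cancel,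
      Real.exp_zero, ENNReal.ofReal_one, mul_one] at this

theorem hasExpBound_iff {φ : (Fin n → ℝ) → ℝ} {U : AxisCube n} {s K : ℝ} :
    HasExpBound φ U s K ↔ ∀ J : AxisCube n, J.IsSubcube U →
      ∫⁻ y, ENNReal.ofReal (Real.exp (s * φ y)) ∂J.unif ≤
        ENNReal.ofReal (K * Real.exp (s * mean φ J)) := by
  refine forall₂_congr fun J _ => ?_
  rw [ENNReal.ofReal_mul' (Real.exp_pos _).le]
  exact lintegral_exp_le_iff φ J s _

theorem aInftyChar_exp (U : AxisCube n) (φ : (Fin n → ℝ) → ℝ) (s : ℝ) :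
    aInftyChar U (fun y => Real.exp (s * φ y)) =
      ⨆ (J : AxisCube n) (_ : J.IsSubcube U),
        ∫⁻ y, ENNReal.ofReal (Real.exp (s * (φ y - mean φ J))) ∂J.unif := by
  refine iSup_congr fun J => iSup_congr fun _ => ?_
  simp only [Real.log_exp, lintegral_exp_osc, ← mean_const_mul]
  rfl

theorem aInftyChar_exp_le_iff {U : AxisCube n} {φ : (Fin n → ℝ) → ℝ} {s K : ℝ} :
    aInftyChar U (fun y => Real.exp (s * φ y)) ≤ ENNReal.ofReal K ↔ HasExpBound φ U s K := by
  rw [aInftyChar_exp, iSup₂_le_iff]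
  rfl

theorem lintegral_rpow_osc_le_of_bmoNorm_le {p : ℝ} (hp : 0 < p) {U : AxisCube n}
    {φ : (Fin n → ℝ) → ℝ} {ε : ℝ≥0∞} (h : bmoNorm p U φ ≤ ε) {J : AxisCube n}
    (hJ : J.IsSubcube U) :
    ∫⁻ y, ENNReal.ofReal (|φ y - mean φ J| ^ p) ∂J.unif ≤ ε ^ p := by
  have := (iSup₂_le_iff.1 h) J hJ
  rw [one_div, ENNReal.rpow_inv_le_iff hp] at this
  exact this

theorem bmoNorm_const_mul_le {p : ℝ} (hp : 0 < p) {U : AxisCube n} {φ : (Fin n → ℝ) → ℝ} {s : ℝ}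
    (h0 : 0 ≤ s) (h1 : s ≤ 1) : bmoNorm p U (fun y => s * φ y) ≤ bmoNorm p U φ := by
  refine iSup₂_mono fun J _ => ENNReal.rpow_le_rpow (lintegral_mono fun y => ?_) (by positivity)
  refine ENNReal.ofReal_le_ofReal (Real.rpow_le_rpow (abs_nonneg _) ?_ hp.le)
  have : ⨍ y in J.carrier, s * φ y = s * ⨍ y in J.carrier, φ y := mean_const_mul φ s J
  rw [this, ← mul_sub, abs_mul, abs_of_nonneg h0]
  exact mul_le_of_le_one_left (abs_nonneg _) h1

/-- Reduces BMO^p for every p > 0 to an exponent at most 1, where `exists_exp_bound_of_rpow_bound`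
applies. -/
theorem rpow_min_le {u p : ℝ} (hu : 0 ≤ u) (hp : 0 < p) : u ^ min p 1 ≤ 1 + u ^ p := by
  have hpos := Real.rpow_nonneg hu p
  rcases le_total u 1 with h | h
  · linarith [Real.rpow_le_one hu h (lt_min hp one_pos).le]
  · linarith [Real.rpow_le_rpow_of_exponent_le h (min_le_left p 1)]

theorem mean_rpow_osc_le {p : ℝ} (hp : 0 < p) {U : AxisCube n} {φ : (Fin n → ℝ) → ℝ}
    (hφ : Integrable φ U.unif) {ε : ℝ} (hε : 0 ≤ ε) (h : bmoNorm p U φ ≤ ENNReal.ofReal ε)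
    {J : AxisCube n} (hJ : J.IsSubcube U) :
    mean (fun y => |φ y - mean φ J| ^ min p 1) J ≤ 1 + ε ^ p := by
  have hi := integrable_abs_sub_rpow (hJ.integrable hφ) (lt_min hp one_pos) (min_le_right p 1)
    (mean φ J)
  refine (ENNReal.ofReal_le_ofReal_iff (by positivity)).1 ?_
  rw [mean, ofReal_integral_eq_lintegral_ofReal hi (.of_forall fun y => by positivity)]
  calc ∫⁻ y, ENNReal.ofReal (|φ y - mean φ J| ^ min p 1) ∂J.unif
      ≤ ∫⁻ y, 1 + ENNReal.ofReal (|φ y - mean φ J| ^ p) ∂J.unif := by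
        refine lintegral_mono fun y => ?_
        rw [← ENNReal.ofReal_one, ← ENNReal.ofReal_add zero_le_one (by positivity)]
        exact ENNReal.ofReal_le_ofReal (rpow_min_le (abs_nonneg _) hp)
    _ = 1 + ∫⁻ y, ENNReal.ofReal (|φ y - mean φ J| ^ p) ∂J.unif := by
        rw [lintegral_add_left measurable_const]
        simp
    _ ≤ ENNReal.ofReal (1 + ε ^ p) := by
        rw [ENNReal.ofReal_add zero_le_one (by positivity), ENNReal.ofReal_one,
          ← ENNReal.ofReal_rpow_of_nonneg hε hp.le]
        gcongr
        exact lintegral_rpow_osc_le_of_bmoNorm_le hp h hJ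

/-- The set of exponents at which a `BMO^p` function is uniformly exponentially integrable is
open to the right. -/
theorem HasExpBound.exists_gt {p : ℝ} (hp : 0 < p) {U : AxisCube n} {φ : (Fin n → ℝ) → ℝ}
    (hφ : Integrable φ U.unif) {ε : ℝ} (hε : 0 ≤ ε) (h : bmoNorm p U φ ≤ ENNReal.ofReal ε)
    {s K : ℝ} (hs : 0 ≤ s) (hK : 1 ≤ K) (hb : HasExpBound φ U s K) :
    ∃ s' > s, ∃ K', HasExpBound φ U s' K' := by
  rcases hs.eq_or_lt with rfl | hs
  -- Self-improvement multiplies the exponent by 1 + δ and so gives nothing at 0; there the BMO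
  -- bound is used.
  · obtain ⟨t, ht, hJN⟩ := exists_exp_bound_of_rpow_bound hφ (lt_min hp one_pos)
      (min_le_right p 1) (by positivity) fun J hJ => mean_rpow_osc_le hp hφ hε h hJ
    exact ⟨t, ht, 4, hasExpBound_iff.2 hJN⟩
  · obtain ⟨δ, hδ, K', hK'⟩ := exists_exp_bound_of_exp_bound (hφ.const_mul s) hK (fun J hJ => by
      rw [mean_const_mul]
      exact hasExpBound_iff.1 hb J hJ)
    refine ⟨(1 + δ) * s, by nlinarith, K', hasExpBound_iff.2 fun J hJ => ?_⟩
    simpa only [mean_const_mul, mul_assoc] using hK' J hJ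

theorem HasExpBound.mono {U : AxisCube n} {φ : (Fin n → ℝ) → ℝ} {s K K' : ℝ}
    (hb : HasExpBound φ U s K) (h : K ≤ K') : HasExpBound φ U s K' :=
  fun J hJ => (hb J hJ).trans (ENNReal.ofReal_le_ofReal h)

/-- Convexity of the exponential in s. However large K' is, the bound just beyond s is therefore
only slightly above K. -/
theorem HasExpBound.convex {U : AxisCube n} {φ : (Fin n → ℝ) → ℝ} {s s' K K' l : ℝ}
    (hb : HasExpBound φ U s K) (hb' : HasExpBound φ U s' K') (hK : 0 ≤ K) (hK' : 0 ≤ K')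
    (h0 : 0 ≤ l) (h1 : l ≤ 1) (hφ : Integrable φ U.unif) :
    HasExpBound φ U ((1 - l) * s + l * s') ((1 - l) * K + l * K') := by
  intro J hJ
  have hl : 0 ≤ 1 - l := sub_nonneg.2 h1
  have hm : ∀ s : ℝ, AEMeasurable
      (fun y => ENNReal.ofReal (Real.exp (s * (φ y - mean φ J)))) J.unif := fun s =>
    (Real.measurable_exp.comp_aemeasurable
      (((hJ.integrable hφ).1.aemeasurable.sub_const _).const_mul s)).ennreal_ofReal
  calc ∫⁻ y, ENNReal.ofReal (Real.exp (((1 - l) * s + l * s') * (φ y - mean φ J))) ∂J.unif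
      ≤ ∫⁻ y, ENNReal.ofReal (1 - l) * ENNReal.ofReal (Real.exp (s * (φ y - mean φ J))) +
          ENNReal.ofReal l * ENNReal.ofReal (Real.exp (s' * (φ y - mean φ J))) ∂J.unif := by
        refine lintegral_mono fun y => ?_
        rw [← ENNReal.ofReal_mul hl, ← ENNReal.ofReal_mul h0,
          ← ENNReal.ofReal_add (by positivity) (by positivity)]
        refine ENNReal.ofReal_le_ofReal ?_
        have := convexOn_exp.2 (mem_univ (s * (φ y - mean φ J)))
          (mem_univ (s' * (φ y - mean φ J))) hl h0 (sub_add_cancel 1 l)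
        simp only [smul_eq_mul] at this
        rwa [← mul_assoc, ← mul_assoc, ← add_mul] at this
    _ = ENNReal.ofReal (1 - l) * (∫⁻ y, ENNReal.ofReal (Real.exp (s * (φ y - mean φ J))) ∂J.unif) +
          ENNReal.ofReal l *
            ∫⁻ y, ENNReal.ofReal (Real.exp (s' * (φ y - mean φ J))) ∂J.unif := by
        rw [lintegral_add_left' ((hm s).const_mul _), lintegral_const_mul' _ _ ENNReal.ofReal_ne_top,
          lintegral_const_mul' _ _ ENNReal.ofReal_ne_top]
    _ ≤ ENNReal.ofReal (1 - l) * ENNReal.ofReal K + ENNReal.ofReal l * ENNReal.ofReal K' := by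
        gcongr
        · exact hb J hJ
        · exact hb' J hJ
    _ = _ := by
        rw [← ENNReal.ofReal_mul hl, ← ENNReal.ofReal_mul h0,
          ← ENNReal.ofReal_add (by positivity) (by positivity)]

/-- Fatou's lemma on each subcube; it makes the supremum of admissible exponents admissible. -/
theorem HasExpBound.of_tendsto {U : AxisCube n} {φ : (Fin n → ℝ) → ℝ} (hφ : Integrable φ U.unif)
    {s : ℕ → ℝ} {s₀ K : ℝ} (hs : Tendsto s atTop (nhds s₀)) (hb : ∀ k, HasExpBound φ U (s k) K) :
    HasExpBound φ U s₀ K := by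
  intro J hJ
  have hm : ∀ k, AEMeasurable
      (fun y => ENNReal.ofReal (Real.exp (s k * (φ y - mean φ J)))) J.unif := fun k =>
    (Real.measurable_exp.comp_aemeasurable
      (((hJ.integrable hφ).1.aemeasurable.sub_const _).const_mul _)).ennreal_ofReal
  calc ∫⁻ y, ENNReal.ofReal (Real.exp (s₀ * (φ y - mean φ J))) ∂J.unif
      = ∫⁻ y, liminf (fun k => ENNReal.ofReal (Real.exp (s k * (φ y - mean φ J)))) atTop
          ∂J.unif := by
        refine lintegral_congr fun y => (Tendsto.liminf_eq ?_).symm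
        exact ENNReal.tendsto_ofReal ((Real.continuous_exp.tendsto _).comp (hs.mul_const _))
    _ ≤ liminf (fun k => ∫⁻ y, ENNReal.ofReal (Real.exp (s k * (φ y - mean φ J))) ∂J.unif) atTop :=
        lintegral_liminf_le' hm
    _ ≤ ENNReal.ofReal K := by
        refine liminf_le_of_le (by isBoundedDefault) fun b hb' => ?_
        obtain ⟨k, hk⟩ := hb'.exists
        exact hk.trans (hb k J hJ)

theorem hasExpBound_zero (φ : (Fin n → ℝ) → ℝ) (U : AxisCube n) {K : ℝ} (hK : 1 ≤ K) :
    HasExpBound φ U 0 K := by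
  intro J _
  simpa using hK

/-- If the `A_∞` characteristic of `e^φ` exceeds `C > 1`, then some `e^{sφ}` with `0 ≤ s ≤ 1` has
characteristic exactly `C`. -/
theorem exists_aInftyChar_eq {p : ℝ} (hp : 0 < p) {U : AxisCube n} {φ : (Fin n → ℝ) → ℝ}
    (hφ : Integrable φ U.unif) {ε : ℝ} (hε : 0 ≤ ε) (h : bmoNorm p U φ ≤ ENNReal.ofReal ε)
    {C : ℝ} (hC : 1 < C) (hlarge : ¬ HasExpBound φ U 1 C) :
    ∃ s, 0 ≤ s ∧ s ≤ 1 ∧ aInftyChar U (fun y => Real.exp (s * φ y)) = ENNReal.ofReal C := by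
  set S := {s : ℝ | 0 ≤ s ∧ s ≤ 1 ∧ HasExpBound φ U s C} with hS
  have h0S : (0 : ℝ) ∈ S := ⟨le_rfl, zero_le_one, hasExpBound_zero φ U hC.le⟩
  have hbdd : BddAbove S := ⟨1, fun s hs => hs.2.1⟩
  obtain ⟨u, -, hu, huS⟩ := exists_seq_tendsto_sSup ⟨0, h0S⟩ hbdd
  set s := sSup S
  have hs0 : 0 ≤ s := le_csSup hbdd h0S
  have hs1 : s ≤ 1 := csSup_le ⟨0, h0S⟩ fun s hs => hs.2.1
  have hsb : HasExpBound φ U s C := .of_tendsto hφ hu fun k => (huS k).2.2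
  have hs1' : s < 1 := hs1.lt_of_ne fun he => hlarge (he ▸ hsb)
  refine ⟨s, hs0, hs1, (aInftyChar_exp_le_iff.2 hsb).antisymm (not_lt.1 fun hlt => ?_)⟩
  set a := aInftyChar U (fun y => Real.exp (s * φ y))
  have ha : a ≤ ENNReal.ofReal (max 1 a.toReal) :=
    (ENNReal.ofReal_toReal hlt.ne_top).ge.trans (ENNReal.ofReal_le_ofReal (le_max_right _ _))
  have haC : max 1 a.toReal < C :=
    max_lt hC ((ENNReal.lt_ofReal_iff_toReal_lt hlt.ne_top).1 hlt)
  set C' := max 1 a.toReal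
  have hC' : 1 ≤ C' := le_max_left _ _
  have hbC' : HasExpBound φ U s C' := aInftyChar_exp_le_iff.1 ha
  obtain ⟨s', hs', K', hb'⟩ := hbC'.exists_gt hp hφ hε h hs0 hC'
  have hb'' := hb'.mono (le_max_left K' 0)
  have hev : ∀ᶠ l in nhdsWithin (0 : ℝ) (Ioi 0),
      (1 - l) * s + l * s' < 1 ∧ (1 - l) * C' + l * max K' 0 < C ∧ l < 1 := by
    refine Eventually.and ?_ (Eventually.and ?_ ?_) <;> refine nhdsWithin_le_nhds ?_
    · have : Tendsto (fun l : ℝ => (1 - l) * s + l * s') (nhds 0) (nhds ((1 - 0) * s + 0 * s')) :=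
        Continuous.tendsto (by fun_prop) 0
      exact this.eventually_lt_const (by simpa using hs1')
    · have : Tendsto (fun l : ℝ => (1 - l) * C' + l * max K' 0) (nhds 0)
          (nhds ((1 - 0) * C' + 0 * max K' 0)) := Continuous.tendsto (by fun_prop) 0
      exact this.eventually_lt_const (by simpa using haC)
    · exact eventually_lt_nhds one_pos
  obtain ⟨l, ⟨hl1, hl2, hl3⟩, hl0⟩ := (hev.and self_mem_nhdsWithin).exists
  have hl0' : 0 < l := hl0
  have hgt : s < (1 - l) * s + l * s' := by nlinarith
  refine absurd (le_csSup hbdd ⟨hs0.trans hgt.le, hl1.le, ?_⟩) (not_le.2 hgt)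
  exact (hbC'.convex hb'' (by linarith) (le_max_right _ _) hl0'.le hl3.le hφ).mono hl2.le

/-! ### The Bellman function bounds the oscillation from below -/

theorem mean_comp_transplant (Q J I : AxisCube n) (f : (Fin n → ℝ) → ℝ) :
    mean (fun y => f (transplant Q J y)) I = mean f (image Q J I) := by
  rw [mean, mean, ← map_transplant_unif Q J I,
    (measurableEmbedding_transplant Q J).integral_map]

theorem lintegral_comp_transplant (Q J I : AxisCube n) (f : (Fin n → ℝ) → ℝ≥0∞) :
    ∫⁻ y, f (transplant Q J y) ∂I.unif = ∫⁻ y, f y ∂(image Q J I).unif := by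
  rw [← map_transplant_unif Q J I, (measurableEmbedding_transplant Q J).lintegral_map]

theorem integrable_comp_transplant (Q J : AxisCube n) {f : (Fin n → ℝ) → ℝ}
    (hf : Integrable f J.unif) : Integrable (fun y => f (transplant Q J y)) Q.unif := by
  rw [← image_self Q J, ← map_transplant_unif Q J Q] at hf
  exact (measurableEmbedding_transplant Q J).integrable_map_iff.1 hf

/-- On every subcube, the `p`-oscillation dominates the lower Bellman function at the point given
by the exponential oscillation. -/
theorem lowerBellman_le {p : ℝ} {U J : AxisCube n} (Q : AxisCube n) (hJ : J.IsSubcube U)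
    {φ : (Fin n → ℝ) → ℝ} (hφ : Integrable φ U.unif) {C : ℝ}
    (hC : aInftyChar U (fun y => Real.exp (φ y)) ≤ ENNReal.ofReal C) :
    lowerBellman p C Q
        (0, (∫⁻ y, ENNReal.ofReal (Real.exp (φ y - mean φ J)) ∂J.unif).toReal) ≤
      ∫⁻ y, ENNReal.ofReal (|φ y - mean φ J| ^ p) ∂J.unif := by
  -- The oscillation of φ on J carried over to Q; subcubes of Q correspond to subcubes of J, so the
  -- bound C on the characteristic persists.
  set ψ : (Fin n → ℝ) → ℝ := fun y => φ (transplant Q J y) - mean φ J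
  have hb : HasExpBound φ U 1 C := aInftyChar_exp_le_iff.1 (by simpa only [one_mul] using hC)
  have hφJ := hJ.integrable hφ
  have he : Integrable (fun y => Real.exp (φ y - mean φ J)) J.unif := by
    refine ⟨Real.continuous_exp.comp_aestronglyMeasurable (hφJ.sub (integrable_const _)).1, ?_⟩
    rw [hasFiniteIntegral_iff_ofReal (.of_forall fun y => (Real.exp_pos _).le)]
    have := hb J hJ
    simp only [one_mul] at this
    exact this.trans_lt ENNReal.ofReal_lt_top
  have hmean : ∀ I : AxisCube n, I.IsSubcube Q →
      mean ψ I = mean φ (image Q J I) - mean φ J := by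
    intro I hI
    have hI' := (image_isSubcube (J := J) hI).trans hJ
    rw [mean_comp_transplant Q J I fun y => φ y - mean φ J, mean,
      integral_sub (hI'.integrable hφ) (integrable_const _)]
    simp [mean]
  have hψ : ψ ∈ testFunctions
      (0, (∫⁻ y, ENNReal.ofReal (Real.exp (φ y - mean φ J)) ∂J.unif).toReal) C Q := by
    refine ⟨integrable_unif_iff.1 (integrable_comp_transplant Q J
      (f := fun y => φ y - mean φ J) (hφJ.sub (integrable_const _))), ?_,
      integrable_unif_iff.1 (integrable_comp_transplant Q J he), ?_, ?_⟩
    · change mean ψ Q = 0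
      rw [hmean Q (.refl Q), image_self, sub_self]
    · change mean (fun y => Real.exp (φ (transplant Q J y) - mean φ J)) Q = _
      rw [mean_comp_transplant Q J Q fun y => Real.exp (φ y - mean φ J), image_self, mean,
        integral_eq_lintegral_of_nonneg_ae (.of_forall fun y => (Real.exp_pos _).le) he.1]
    · have : HasExpBound ψ Q 1 C := by
        intro I hI
        rw [hmean I hI]
        simp only [ψ, sub_sub_sub_cancel_right]
        rw [lintegral_comp_transplant Q J I fun y =>
          ENNReal.ofReal (Real.exp (1 * (φ y - mean φ (image Q J I))))]
        exact hb _ ((image_isSubcube hI).trans hJ)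
      simpa only [one_mul] using aInftyChar_exp_le_iff.2 this
  refine (iInf₂_le ψ hψ).trans_eq ?_
  rw [cubeAvg_eq, lintegral_comp_transplant Q J Q fun y => ENNReal.ofReal (|φ y - mean φ J| ^ p),
    image_self]

/-- A function whose exponential has characteristic exactly `C` has `BMO^p` norm at least
`b_C(0,C)^{1/p}`. -/
theorem bellman_le_rpow {p : ℝ} (hp : 0 < p) {U Q : AxisCube n} {b : ℝ × ℝ → ℝ} {C : ℝ}
    (hC : 1 < C)
    (hb : ∀ x ∈ bellmanDomain C, ((b x : ℝ) : EReal) ≤ ((lowerBellman p C Q x : ℝ≥0∞) : EReal))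
    (hcont : ContinuousOn (fun t : ℝ => b (0, t)) (Icc 1 C))
    {φ : (Fin n → ℝ) → ℝ} (hφ : Integrable φ U.unif) {ε : ℝ} (hε : 0 ≤ ε)
    (h : bmoNorm p U φ ≤ ENNReal.ofReal ε)
    (hchar : aInftyChar U (fun y => Real.exp (φ y)) = ENNReal.ofReal C) :
    b (0, C) ≤ ε ^ p := by
  -- The supremum defining the characteristic need not be attained, so only values r arbitrarily
  -- close to C are available; continuity of b(0, ·) at C finishes.
  have hfreq : ∀ t ∈ Ioo 1 C, ∃ r ∈ Ioc t C, b (0, r) ≤ ε ^ p := by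
    intro t ht
    have hchar' : ENNReal.ofReal t < aInftyChar U (fun y => Real.exp (1 * φ y)) := by
      simp only [one_mul, hchar]
      exact (ENNReal.ofReal_lt_ofReal_iff (by linarith)).2 ht.2
    rw [aInftyChar_exp] at hchar'
    simp only [one_mul] at hchar'
    obtain ⟨J, hJ'⟩ := lt_iSup_iff.1 hchar'
    obtain ⟨hJ, hlt⟩ := lt_iSup_iff.1 hJ'
    have hle : ∫⁻ y, ENNReal.ofReal (Real.exp (φ y - mean φ J)) ∂J.unif ≤ ENNReal.ofReal C := by
      have hB : HasExpBound φ U 1 C := aInftyChar_exp_le_iff.1 (by simp only [one_mul, hchar, le_refl])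
      simpa only [one_mul] using hB J hJ
    have hne := (hle.trans_lt ENNReal.ofReal_lt_top).ne
    set r := (∫⁻ y, ENNReal.ofReal (Real.exp (φ y - mean φ J)) ∂J.unif).toReal
    have htr : t < r := (ENNReal.ofReal_lt_iff_lt_toReal (by linarith [ht.1]) hne).1 hlt
    have hrC : r ≤ C := ENNReal.toReal_le_of_le_ofReal (by linarith) hle
    refine ⟨r, ⟨htr, hrC⟩, ?_⟩
    have h1 := (hb (0, r) ⟨by simpa using ht.1.le.trans htr.le, by simpa using hrC⟩).trans
      (EReal.coe_ennreal_le_coe_ennreal_iff.2 ((lowerBellman_le Q hJ hφ hchar.le).trans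
        (lintegral_rpow_osc_le_of_bmoNorm_le hp h hJ)))
    rw [ENNReal.ofReal_rpow_of_nonneg hε hp.le, EReal.coe_ennreal_ofReal,
      max_eq_left (by positivity)] at h1
    exact_mod_cast h1
  by_contra! hlt
  have hev := (hcont C ⟨hC.le, le_rfl⟩).eventually (lt_mem_nhds hlt)
  rw [eventually_nhdsWithin_iff] at hev
  obtain ⟨t, htC, ht⟩ := exists_Ioc_subset_of_mem_nhds hev ⟨1, hC⟩
  obtain ⟨r, hr, hbr⟩ := hfreq (max t ((1 + C) / 2))
    ⟨lt_max_of_lt_right (by linarith), max_lt htC (by linarith)⟩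
  have hr1 : 1 ≤ r := by linarith [(le_max_right t ((1 + C) / 2)).trans hr.1.le]
  exact absurd hbr (not_le.2 (ht ⟨(le_max_left _ _).trans_lt hr.1, hr.2⟩ ⟨hr1, hr.2⟩))

end AxisCube

/-! ### The bounds for ε₀(p) and C(ε, p) -/

theorem IntegralJN.anti {n : ℕ} {p : ℝ} {ε ε' K : ℝ≥0∞} (h : IntegralJN n p ε' K) (hε : ε ≤ ε') :
    IntegralJN n p ε K :=
  fun φ hφ hn => h φ hφ (hn.trans hε)

/-- Dividing by e^{⟨φ⟩_J} and taking the supremum over J shows that C(ε, p) is the supremum of the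
characteristics at level ε. -/
theorem integralJN_iff {n : ℕ} {p : ℝ} {ε K : ℝ≥0∞} :
    IntegralJN n p ε K ↔ ∀ φ : (Fin n → ℝ) → ℝ, MemBMO p (unitCube n) φ →
      bmoNorm p (unitCube n) φ ≤ ε → aInftyChar (unitCube n) (fun y => Real.exp (φ y)) ≤ K := by
  refine forall₃_congr fun φ _ _ => ?_
  have h := AxisCube.aInftyChar_exp (unitCube n) φ 1
  simp only [one_mul] at h
  rw [h, iSup₂_le_iff]
  refine forall₂_congr fun J _ => ?_
  have := AxisCube.lintegral_exp_le_iff φ J 1 K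
  simp only [one_mul] at this
  rw [this]
  rfl

theorem mainTheorem3 (n : ℕ) (hn : 1 ≤ n) (p : ℝ) (hp : 0 < p) (Q : AxisCube n)
    (b : ℝ → ℝ × ℝ → ℝ)
    (hb : ∀ C : ℝ, 1 ≤ C → ∀ x ∈ bellmanDomain C,
      ((b C x : ℝ) : EReal) ≤ ((lowerBellman p C Q x : ℝ≥0∞) : EReal))
    (hcont : ∀ C : ℝ, 1 ≤ C → ContinuousOn (fun t : ℝ => b C (0, t)) (Set.Icc 1 C)) :
    Filter.limsup (fun C : ℝ => ((b C (0, C) : ℝ) : EReal)) Filter.atTop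
        ≤ ((epsZero n p ^ p : ℝ≥0∞) : EReal) ∧
      ∀ (G : ℝ → ℝ) (C₀ : ℝ), 1 ≤ C₀ →
        (∀ C : ℝ, C₀ ≤ C → 0 ≤ b C (0, C) ∧ G C = b C (0, C) ^ (1 / p)) →
        StrictMonoOn G (Set.Ici C₀) →
        ∀ ε : ℝ, G C₀ ≤ ε → ENNReal.ofReal ε < epsZero n p →
          (∀ C' : ℝ, C₀ ≤ C' → G C' = ε → jnConst n (ENNReal.ofReal ε) p ≤ ENNReal.ofReal C') ∧
          jnConst n (ENNReal.ofReal ε) p ≤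
            ⨆ (C : ℝ) (_ : C₀ ≤ C ∧ G C ≤ ε), ENNReal.ofReal C := by
  have hbell : ∀ (C ε : ℝ) (φ : (Fin n → ℝ) → ℝ), 1 < C → 0 ≤ ε →
      IntegrableOn φ (unitCube n).carrier → bmoNorm p (unitCube n) φ ≤ ENNReal.ofReal ε →
      aInftyChar (unitCube n) (fun y => Real.exp (φ y)) = ENNReal.ofReal C →
      b C (0, C) ≤ ε ^ p := fun C ε φ hC hε hφ =>
    AxisCube.bellman_le_rpow hp hC (hb C hC.le) (hcont C hC.le)
      (AxisCube.integrable_unif_iff.2 hφ) hε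
  constructor
  · rcases eq_or_ne (epsZero n p) ∞ with htop | htop
    · simp [htop, hp]
    -- Above ε₀(p) no finite constant works, so every C > 1 is exceeded by some characteristic;
    -- scaling φ down to reach C exactly does not increase its norm.
    have hlim : ∀ ε ∈ Ioi (epsZero n p).toReal,
        Filter.limsup (fun C : ℝ => ((b C (0, C) : ℝ) : EReal)) Filter.atTop ≤
          ((ε ^ p : ℝ) : EReal) := by
      intro ε hε
      have hε0 : 0 ≤ ε := ENNReal.toReal_nonneg.trans (le_of_lt hε)
      have hlt : epsZero n p < ENNReal.ofReal ε := (ENNReal.lt_ofReal_iff_toReal_lt htop).2 hε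
      refine limsup_le_of_le (by isBoundedDefault) ?_
      filter_upwards [eventually_gt_atTop 1] with C hC
      have hnot : ¬ IntegralJN n p (ENNReal.ofReal ε) (ENNReal.ofReal C) := fun hJN =>
        not_le.2 hlt (le_sSup ⟨_, ENNReal.ofReal_lt_top, hJN⟩)
      rw [integralJN_iff] at hnot
      push Not at hnot
      obtain ⟨φ, hφ, hnorm, hchar⟩ := hnot
      have hφi := AxisCube.integrable_unif_iff.2 hφ.1
      obtain ⟨s, hs0, hs1, hs⟩ := AxisCube.exists_aInftyChar_eq hp hφi hε0 hnorm hC fun hB =>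
        not_le.2 hchar (by simpa only [one_mul] using AxisCube.aInftyChar_exp_le_iff.2 hB)
      exact_mod_cast hbell C ε _ hC hε0 (hφ.1.const_mul s)
        ((AxisCube.bmoNorm_const_mul_le hp hs0 hs1).trans hnorm) hs
    have hval : ((epsZero n p ^ p : ℝ≥0∞) : EReal) = (((epsZero n p).toReal ^ p : ℝ) : EReal) := by
      conv_lhs => rw [← ENNReal.ofReal_toReal htop]
      rw [ENNReal.ofReal_rpow_of_nonneg ENNReal.toReal_nonneg hp.le, EReal.coe_ennreal_ofReal,
        max_eq_left (by positivity)]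
    rw [hval]
    have htend : Tendsto (fun ε : ℝ => ((ε ^ p : ℝ) : EReal))
        (nhdsWithin (epsZero n p).toReal (Ioi (epsZero n p).toReal))
        (nhds (((epsZero n p).toReal ^ p : ℝ) : EReal)) :=
      (continuous_coe_real_ereal.tendsto _).comp
        ((Real.continuousAt_rpow_const _ _ (.inr hp.le)).tendsto.mono_left nhdsWithin_le_nhds)
    exact ge_of_tendsto htend (eventually_mem_nhdsWithin.mono hlim)
  · intro G C₀ hC₀ hG hmono ε hε hlt
    have hε0 : 0 ≤ ε := by
      refine le_trans ?_ hε
      rw [(hG C₀ le_rfl).2]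
      exact Real.rpow_nonneg (hG C₀ le_rfl).1 _
    have hsup : jnConst n (ENNReal.ofReal ε) p ≤
        ⨆ (C : ℝ) (_ : C₀ ≤ C ∧ G C ≤ ε), ENNReal.ofReal C := by
      refine sInf_le (integralJN_iff.2 fun φ hφ hnorm => ?_)
      -- The inequality ε < ε₀(p) serves to make the characteristic a finite; its size is then
      -- bounded through G(a) ≤ ε.
      obtain ⟨ε', ⟨K, hK, hJN⟩, hε'⟩ := lt_sSup_iff.1 hlt
      have hfin := (integralJN_iff.1 (hJN.anti hε'.le) φ hφ hnorm).trans_lt hK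
      set a := aInftyChar (unitCube n) (fun y => Real.exp (φ y)) with ha
      rw [← ENNReal.ofReal_toReal hfin.ne]
      rcases le_or_gt a.toReal C₀ with h | h
      · exact (ENNReal.ofReal_le_ofReal h).trans
          (le_iSup₂_of_le C₀ ⟨le_rfl, hε⟩ le_rfl)
      · refine le_iSup₂_of_le a.toReal ⟨h.le, ?_⟩ le_rfl
        have := hbell a.toReal ε φ (hC₀.trans_lt h) hε0 hφ.1 hnorm
          (ENNReal.ofReal_toReal hfin.ne).symm
        rw [(hG _ h.le).2, one_div, Real.rpow_inv_le_iff_of_pos (hG _ h.le).1 hε0 hp]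
        exact this
    -- When ε = G(C'), strict monotonicity collapses the generalised inverse to C'.
    refine ⟨fun C' hC' hGC' => hsup.trans (iSup₂_le fun C hC => ?_), hsup⟩
    exact ENNReal.ofReal_le_ofReal ((hmono.le_iff_le hC.1 hC').1 (hC.2.trans_eq hGC'.symm))
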